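/- A metric graph $\Gamma$ is obtained from a finite connected weighted multigraph by replacing each edge $e$ with a closed interval of length $\ell(e)>0$ and gluing the endpoints; we present it so that the vertices of the multigraph are exactly the combinatorial vertices of $\Gamma$, i.e. the points of degree other than $2$. A divisor on $\Gamma$ is a finite formal sum $D=\sum_p D(p)\,p$ of points of $\Gamma$ with integer coefficients; $D(p)$ is the number of chips at $p$. Fix a combinatorial vertex $q$. A firing $f$ consists of a partition of the combinatorial vertices into two sets $A$ and $B$, both inducing connected subgraphs, a length $\epsilon(f)>0$ smaller than the length of every edge between $A$ and $B$, and, on every such edge, an open subinterval of length $\epsilon(f)$. Applied to $D$, it pushes one chip across each of these subintervals, from the endpoint nearer to $A$ to the endpoint nearer to $B$. For a divisor $D$ that is nonnegative at all points other than $q$, the firing $f$ is legal towards $q$ if $q\in B$ and the resulting divisor is again nonnegative at all points other than $q$; it is a maximal legal firing if in addition its length is maximum among all legal firings along the same cut $(A,B)$. For an ordinal $\tau$, a greedy reduction of $D$ with respect to $q$ that runs for time $\tau$ is a family of divisors $(D_\alpha)_{\alpha\le\tau}$ such that $D_0=D$; for every $\alpha<\tau$, $D_{\alpha+1}$ is obtained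 from $D_\alpha$ by a maximal legal firing towards $q$; and for every limit ordinal $\lambda\le\tau$, $D_\lambda$ is the limit of $D_\alpha$ as $\alpha\to\lambda$, $\alpha<\lambda$ (that is, $\sum_p D_\alpha(p)\varphi(p)\to\sum_p D_\lambda(p)\varphi(p)$ for every continuous $\varphi:\Gamma\to\mathbb{R}$). **Theorem.** For every $n\in\mathbb{N}$ there exist a metric graph $\Gamma$, a combinatorial vertex $q$ of $\Gamma$, a divisor $D$ on $\Gamma$ with $D(p)\ge 0$ for all $p\in\Gamma$ with $p\ne q$, and a greedy reduction of $D$ with respect to $q$ that runs for an ordinal time $\tau\ge\omega^n$. -/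

import Mathlib

/-- A finite multigraph (loops and parallel edges allowed) with positive edge lengths.  Each edge
`e` carries an auxiliary orientation from `src e` to `tgt e`, used only to parametrize it. -/
structure WeightedGraph where
  V : Type
  E : Type
  [fintypeV : Fintype V]
  [fintypeE : Fintype E]
  src : E → V
  tgt : E → V
  length : E → ℝ
  length_pos : ∀ e, 0 < length e

namespace WeightedGraph

attribute [instance] WeightedGraph.fintypeV WeightedGraph.fintypeE

variable (G : WeightedGraph)

/-- The number of tangent directions at a vertex (a loop counts twice). -/
noncomputable def degree (v : G.V) : ℕ :=
  Nat.card {e : G.E // G.src e = v} + Nat.card {e : G.E // G.tgt e = v}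

/-- The simple graph of adjacency between distinct vertices. -/
def adjGraph : SimpleGraph G.V :=
  SimpleGraph.fromRel (fun u v => ∃ e, G.src e = u ∧ G.tgt e = v)

end WeightedGraph

/-- A (compact, connected) metric graph, presented by the edge-weighted graph whose vertices are
exactly its combinatorial vertices, i.e. the points of degree other than two. -/
structure MetricGraph extends WeightedGraph where
  connected : toWeightedGraph.adjGraph.Connected
  degree_ne_two : ∀ v, toWeightedGraph.degree v ≠ 2

namespace MetricGraph

variable (Γ : MetricGraph)

/-- The points of `Γ`: its combinatorial vertices, and for every edge `e` the points of the open
interval `(0, length e)`, where `t` is the distance from `src e` measured along `e`. -/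
inductive Point : Type
  | vertex (v : Γ.V) : Point
  | interior (e : Γ.E) (t : Set.Ioo (0 : ℝ) (Γ.length e)) : Point

variable {Γ}

open Classical in
/-- The parametrization of the closed edge `e` by `[0, length e]`: the point of `e` at distance
`t` from `src e`. -/
noncomputable def pt (e : Γ.E) (t : ℝ) : Γ.Point :=
  if h : t ∈ Set.Ioo (0 : ℝ) (Γ.length e) then Point.interior e ⟨t, h⟩
  else if t ≤ 0 then Point.vertex (Γ.src e)
  else Point.vertex (Γ.tgt e)

/-- `Γ` carries the topology obtained by gluing the closed intervals `[0, length e]` along their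
endpoints (which for a finite graph is also the topology of the path metric). -/
noncomputable instance : TopologicalSpace Γ.Point :=
  TopologicalSpace.coinduced
    (fun x : (Σ e : Γ.E, Set.Icc (0 : ℝ) (Γ.length e)) => pt x.1 (x.2 : ℝ)) inferInstance

variable (Γ) in
/-- Divisors on `Γ`: finite formal sums of points with integer coefficients. -/
abbrev Divisor : Type := Γ.Point →₀ ℤ

/-- The integral of a function against a divisor, `∑ D(p) φ(p)`. -/
noncomputable def Divisor.eval (D : Γ.Divisor) (φ : Γ.Point → ℝ) : ℝ :=
  D.sum (fun p k => (k : ℝ) * φ p)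

/-- `D(p) ≥ 0` at all points other than `q`. -/
def Divisor.NonnegAwayFrom (D : Γ.Divisor) (q : Γ.V) : Prop :=
  ∀ p : Γ.Point, p ≠ Point.vertex q → 0 ≤ D p

/-- The edges with one endpoint in `A` and the other one outside `A`. -/
def IsCutEdge (A : Set Γ.V) (e : Γ.E) : Prop :=
  (Γ.src e ∈ A ∧ Γ.tgt e ∉ A) ∨ (Γ.src e ∉ A ∧ Γ.tgt e ∈ A)

open Classical in
/-- The point at distance `t` from the endpoint in `A`, on an edge of the cut of `A`. -/
noncomputable def along (A : Set Γ.V) (e : Γ.E) (t : ℝ) : Γ.Point :=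
  if Γ.src e ∈ A then pt e t else pt e (Γ.length e - t)

variable (Γ) in
/-- A basic chip-firing move: a minimal cut `(A, Aᶜ)` of the combinatorial vertices (both sides
induce connected subgraphs), a positive length `ε` smaller than the length of every cut edge, and
on every cut edge `e` the open interval of length `ε` that starts at distance `start e` from the
endpoint of `e` in `A`.  It pushes one chip across each interval, away from `A`.
(The value of `start` on edges outside of the cut plays no role.) -/
structure Firing where
  A : Set Γ.V
  connected : (Γ.adjGraph.induce A).Connected
  connected_compl : (Γ.adjGraph.induce Aᶜ).Connected
  ε : ℝ
  ε_pos : 0 < ε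
  ε_lt : ∀ e, IsCutEdge A e → ε < Γ.length e
  start : Γ.E → ℝ
  start_nonneg : ∀ e, IsCutEdge A e → 0 ≤ start e
  start_add_le : ∀ e, IsCutEdge A e → start e + ε ≤ Γ.length e

open Classical in
/-- The divisor of a firing: on every cut edge, `+1` at the endpoint of the interval closer to `A`
and `-1` at the other one.  Firing `f` replaces `D` by `D - f.Q`. -/
noncomputable def Firing.Q (f : Γ.Firing) : Γ.Divisor :=
  ∑ e : Γ.E with IsCutEdge f.A e,
    (Finsupp.single (along f.A e (f.start e)) 1
      - Finsupp.single (along f.A e (f.start e + f.ε)) 1)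

/-- `f` is a legal firing of `D` towards `q`. -/
structure Firing.IsLegal (f : Γ.Firing) (q : Γ.V) (D : Γ.Divisor) : Prop where
  toward : q ∉ f.A
  nonneg : Divisor.NonnegAwayFrom (D - f.Q) q

/-- `f` is a maximal legal firing of `D` towards `q`: a legal firing whose length is maximum among
the legal firings along the same cut. -/
structure Firing.IsMaximalLegal (f : Γ.Firing) (q : Γ.V) (D : Γ.Divisor) : Prop where
  legal : f.IsLegal q D
  maximal : ∀ g : Γ.Firing, g.A = f.A → g.IsLegal q D → g.ε ≤ f.ε

/-- `S` (restricted to the ordinals `≤ τ`) is a greedy reduction of `D` with respect to `q` that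
runs for time `τ`: at every time `α < τ` a maximal legal firing is performed, and at limit times
the divisor is the limit of the previous ones, in the sense of convergence against all continuous
functions on `Γ`. -/
structure IsGreedyReduction (q : Γ.V) (D : Γ.Divisor) (τ : Ordinal.{0})
    (S : Ordinal.{0} → Γ.Divisor) : Prop where
  zero : S 0 = D
  succ : ∀ α < τ, ∃ f : Γ.Firing, f.IsMaximalLegal q (S α) ∧ S (Order.succ α) = S α - f.Q
  limit : ∀ l ≤ τ, Order.IsSuccLimit l → ∀ φ : C(Γ.Point, ℝ),
    Filter.Tendsto (fun α => (S α).eval φ) (nhdsWithin l (Set.Iio l)) (nhds ((S l).eval φ))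

end MetricGraph

namespace MetricGraph

/-! Take the complete graph with all edges of length 2, put one chip on each edge, and record the
configuration by a potential `f` on the vertices: firing a set `A` by ε adds ε to `f` on `A`, and
the chip of an edge moves with the potential difference. If `f` is small, a chip starting at the
middle of its edge never reaches an end. Only the chips of the edges in a chosen relation `R`, which
sit at the target when `f = 0`, can stop a firing (`MaximalRaise.exists_firing`). The graph thus
becomes a machine whose state is the list of gaps left in front of these chips.

A level of the machine has three gaps. A step opens one gap and closes the two others at unit speed
until one of them vanishes. With μ² = 1 - μ this is a self-similar Euclidean algorithm: three steps
take (0, 1, 1 + μ) to μ³ times itself, so a level runs for ω rounds before all its gaps vanish. The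
same three steps reopen the gaps of the level below to μ(0, 1, 1 + μ), so that this level performs a
whole run within each round (`stepReach_block`). A run of time τ below hence gives a run of time (3
+ τ)ω above (`IsRun.succ`), and level n runs for at least ω^n. Potentials only increase along the
way, which gives the limits (`StepReach.omega0`). -/

theorem pt_of_mem {Γ : MetricGraph} {e : Γ.E} {t : ℝ} (h : t ∈ Set.Ioo (0 : ℝ) (Γ.length e)) :
    pt e t = Point.interior e ⟨t, h⟩ := by
  simp [pt, h.1, h.2]

theorem pt_of_nonpos {Γ : MetricGraph} {e : Γ.E} {t : ℝ} (h : t ≤ 0) :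
    pt e t = Point.vertex (Γ.src e) := by
  simp [pt, h, h.not_gt]

theorem pt_of_length_le {Γ : MetricGraph} {e : Γ.E} {t : ℝ} (h : Γ.length e ≤ t) :
    pt e t = Point.vertex (Γ.tgt e) := by
  have := Γ.length_pos e
  have h2 : ¬ t ≤ 0 := by linarith
  simp [pt, h.not_gt, h2]

theorem continuous_pt {Γ : MetricGraph} (e : Γ.E) : Continuous (pt e : ℝ → Γ.Point) := by
  have hL := (Γ.length_pos e).le
  have h : (pt e : ℝ → Γ.Point) =
      (fun x : (Σ e : Γ.E, Set.Icc (0 : ℝ) (Γ.length e)) => pt x.1 (x.2 : ℝ)) ∘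
        (fun t => ⟨e, Set.projIcc 0 (Γ.length e) hL t⟩) := by
    funext t
    simp only [Function.comp]
    rcases le_total t 0 with h0 | h0
    · rw [Set.projIcc_of_le_left _ h0, pt_of_nonpos h0, pt_of_nonpos le_rfl]
    rcases le_total (Γ.length e) t with h1 | h1
    · rw [Set.projIcc_of_right_le _ h1, pt_of_length_le h1, pt_of_length_le le_rfl]
    · rw [Set.projIcc_of_mem _ ⟨h0, h1⟩]
  rw [h]
  refine continuous_coinduced_rng.comp ?_
  exact continuous_sigmaMk.comp continuous_projIcc

/-! ### The complete metric graph -/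

/-- The metric graph in which every ordered pair of vertices is joined by an edge of length `2`. -/
abbrev complete (V : Type) [Fintype V] [Nontrivial V] : MetricGraph where
  V := V
  E := V × V
  src := Prod.fst
  tgt := Prod.snd
  length _ := 2
  length_pos _ := two_pos
  connected := by
    refine { preconnected := fun u v => ?_, nonempty := inferInstanceAs (Nonempty V) }
    by_cases h : u = v
    · exact h ▸ SimpleGraph.Reachable.refl _
    · exact SimpleGraph.Adj.reachable
        ((SimpleGraph.fromRel_adj _ _ _).2 ⟨h, Or.inl ⟨(u, v), rfl, rfl⟩⟩)
  degree_ne_two v := by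
    have h1 : Nat.card {e : V × V // e.1 = v} = Fintype.card V := by
      rw [← Nat.card_eq_fintype_card]
      exact Nat.card_congr
        { toFun := fun e => e.1.2, invFun := fun w => ⟨(v, w), rfl⟩,
          left_inv := by rintro ⟨⟨a, b⟩, rfl⟩; rfl, right_inv := fun _ => rfl }
    have h2 : Nat.card {e : V × V // e.2 = v} = Fintype.card V := by
      rw [← Nat.card_eq_fintype_card]
      exact Nat.card_congr
        { toFun := fun e => e.1.1, invFun := fun w => ⟨(w, v), rfl⟩,
          left_inv := by rintro ⟨⟨a, b⟩, rfl⟩; rfl, right_inv := fun _ => rfl }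
    have h3 := Fintype.one_lt_card (α := V)
    change Nat.card {e : V × V // e.1 = v} + Nat.card {e : V × V // e.2 = v} ≠ 2
    omega

/-! ### Chip configurations described by potentials -/

section Potential

variable {V : Type}

open Classical in
/-- The position of the chip of the edge `e` when the vertices have been fired according to the
potential `f`.  At potential zero, the chip is at the end of the edges of the relation `R`, and in
the middle of all other edges. -/
noncomputable def chipPos (R : V → V → Prop) (f : V → ℝ) (e : V × V) : ℝ :=
  (if R e.1 e.2 then 2 else 1) + f e.1 - f e.2

/-- The potentials for which the chips of edges outside of `R` stay in the interior of their edge,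
and those of edges in `R` do not cross the target. -/
def IsFeasible (R : V → V → Prop) (f : V → ℝ) : Prop :=
  (∀ v, |f v| < 1 / 2) ∧ ∀ u v, R u v → f u ≤ f v

/-- Raising the potential on a set of vertices away from `q` until an edge of `R` leaving this set
becomes tight. -/
def MaximalRaise (R : V → V → Prop) (q : V) (f f' : V → ℝ) : Prop :=
  IsFeasible R f ∧ IsFeasible R f' ∧ ∃ (A : Set V) (ε : ℝ), q ∉ A ∧ 0 < ε ∧
    f' = f + ε • A.indicator 1 ∧ ∃ u ∈ A, ∃ v ∉ A, R u v ∧ f' u = f' v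

theorem IsFeasible.chipPos_pos {R : V → V → Prop} {f : V → ℝ} (hf : IsFeasible R f) (e : V × V) :
    0 < chipPos R f e := by
  have h1 := abs_lt.1 (hf.1 e.1)
  have h2 := abs_lt.1 (hf.1 e.2)
  unfold chipPos
  split_ifs <;> linarith

theorem IsFeasible.chipPos_le {R : V → V → Prop} {f : V → ℝ} (hf : IsFeasible R f) (e : V × V) :
    chipPos R f e ≤ 2 := by
  have h1 := abs_lt.1 (hf.1 e.1)
  have h2 := abs_lt.1 (hf.1 e.2)
  unfold chipPos
  split_ifs with h
  · linarith [hf.2 _ _ h]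
  · linarith

theorem IsFeasible.chipPos_lt {R : V → V → Prop} {f : V → ℝ} (hf : IsFeasible R f) {e : V × V}
    (h : ¬ R e.1 e.2) : chipPos R f e < 2 := by
  have h1 := abs_lt.1 (hf.1 e.1)
  have h2 := abs_lt.1 (hf.1 e.2)
  rw [chipPos, if_neg h]
  linarith

variable [Fintype V] [Nontrivial V]

/-- This is why the graph is complete: every proper nonempty set of vertices may be fired. -/
theorem complete_induce_connected {A : Set V} (hA : A.Nonempty) :
    ((complete V).adjGraph.induce A).Connected := by
  refine { preconnected := fun u v => ?_, nonempty := hA.to_subtype }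
  by_cases h : u = v
  · exact h ▸ SimpleGraph.Reachable.refl _
  · refine SimpleGraph.Adj.reachable ?_
    exact (SimpleGraph.fromRel_adj (fun u v : V => ∃ e : V × V, e.1 = u ∧ e.2 = v) _ _).2
      ⟨fun h' => h (Subtype.ext h'), Or.inl ⟨((u : V), (v : V)), rfl, rfl⟩⟩

/-- The divisor with one chip per edge, at the positions prescribed by the potential `f`. -/
noncomputable def chips (R : V → V → Prop) (f : V → ℝ) : (complete V).Divisor :=
  ∑ e : V × V, Finsupp.single (pt (Γ := complete V) e (chipPos R f e)) 1

theorem chips_nonneg (R : V → V → Prop) (f : V → ℝ) (p : (complete V).Point) :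
    0 ≤ chips R f p := by
  classical
  rw [chips, Finsupp.finsetSum_apply]
  refine Finset.sum_nonneg fun e _ => ?_
  rw [Finsupp.single_apply]
  split_ifs <;> simp

theorem continuous_eval_chips (R : V → V → Prop) (φ : C((complete V).Point, ℝ)) :
    Continuous fun f : V → ℝ => (chips R f).eval φ := by
  have h : (fun f : V → ℝ => (chips R f).eval φ) =
      fun f => ∑ e : V × V, φ (pt (Γ := complete V) e (chipPos R f e)) := by
    funext f
    rw [chips, Divisor.eval, ← Finsupp.sum_finsetSum_index (by simp) (by intros; push_cast; ring)]
    simp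
  rw [h]
  refine continuous_finsetSum _ fun e _ => φ.continuous.comp ((continuous_pt _).comp ?_)
  unfold chipPos
  fun_prop

/-- There are no chips on the edge `e` before its own chip, provided that `e` starts at a vertex
which is not a target of `R`. -/
theorem chips_apply_eq_zero {R : V → V → Prop} {f : V → ℝ} (hf : IsFeasible R f) {e : V × V}
    (hR : ∀ w, ¬ R w e.1) {s : ℝ} (hs : s < chipPos R f e) :
    chips R f (pt (Γ := complete V) e s) = 0 := by
  classical
  rw [chips, Finsupp.finsetSum_apply]
  refine Finset.sum_eq_zero fun e' _ => ?_
  rw [Finsupp.single_apply, if_neg]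
  intro h
  have hp := hf.chipPos_pos e'
  rcases (hf.chipPos_le e').lt_or_eq with hlt | heq
  · rw [pt_of_mem (Γ := complete V) (e := e') ⟨hp, hlt⟩] at h
    rcases le_or_gt s 0 with h0 | h0
    · rw [pt_of_nonpos h0] at h
      cases h
    · rw [pt_of_mem (Γ := complete V) (e := e) ⟨h0, hs.trans_le (hf.chipPos_le e)⟩] at h
      obtain ⟨rfl, h'⟩ := Point.interior.inj h
      exact hs.ne' (congrArg Subtype.val (eq_of_heq h'))
  · rw [pt_of_length_le (Γ := complete V) (e := e') heq.ge] at h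
    rcases le_or_gt s 0 with h0 | h0
    · rw [pt_of_nonpos h0] at h
      have h' : e'.2 = e.1 := Point.vertex.inj h
      refine (hf.chipPos_lt (e := e') ?_).ne heq
      rw [h']
      exact hR _
    · rw [pt_of_mem (Γ := complete V) (e := e) ⟨h0, hs.trans_le (hf.chipPos_le e)⟩] at h
      cases h

/-- A firing takes a chip from the start of the interval of any cut edge oriented outwards. -/
theorem Firing.Q_pos (g : (complete V).Firing) {e : V × V} (h1 : e.1 ∈ g.A) (h2 : e.2 ∉ g.A) :
    0 < g.Q (pt (Γ := complete V) e (g.start e)) := by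
  classical
  have hcut : IsCutEdge (Γ := complete V) g.A e := Or.inl ⟨h1, h2⟩
  have hal : ∀ t, along (Γ := complete V) g.A e t = pt (Γ := complete V) e t := fun t => if_pos h1
  have hs0 := g.start_nonneg e hcut
  have hs1 : g.start e + g.ε ≤ 2 := g.start_add_le e hcut
  have hε := g.ε_pos
  -- An interval ends at a vertex outside `A` or inside its own edge beyond its start, so no
  -- arriving chip can compensate the one taken from the start of `e`.
  have hne : ∀ e' : V × V, IsCutEdge (Γ := complete V) g.A e' →
      along (Γ := complete V) g.A e' (g.start e' + g.ε) ≠ pt (Γ := complete V) e (g.start e) := by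
    intro e' hc h
    have ht0 : 0 < g.start e' + g.ε := by linarith [g.start_nonneg e' hc]
    have ht1 : g.start e' + g.ε ≤ 2 := g.start_add_le e' hc
    rcases hs0.eq_or_lt with h0 | h0
    · rw [pt_of_nonpos (Γ := complete V) (e := e) h0.ge] at h
      rcases hc with ⟨hc1, hc2⟩ | ⟨hc1, hc2⟩
      · rw [along, if_pos hc1] at h
        rcases ht1.lt_or_eq with ht | ht
        · rw [pt_of_mem (Γ := complete V) (e := e') ⟨ht0, ht⟩] at h
          cases h
        · rw [pt_of_length_le (Γ := complete V) (e := e') ht.ge] at h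
          exact hc2 ((Point.vertex.inj h) ▸ h1)
      · rw [along, if_neg hc1] at h
        change pt (Γ := complete V) e' (2 - (g.start e' + g.ε)) = _ at h
        rcases ht1.lt_or_eq with ht | ht
        · rw [pt_of_mem (Γ := complete V) (e := e')
            ⟨by linarith, show 2 - (g.start e' + g.ε) < 2 by linarith⟩] at h
          cases h
        · rw [pt_of_nonpos (Γ := complete V) (e := e') (by linarith)] at h
          exact hc1 ((Point.vertex.inj h) ▸ h1)
    · have hmem : g.start e ∈ Set.Ioo (0 : ℝ) ((complete V).length e) :=
        ⟨h0, show g.start e < 2 by linarith⟩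
      by_cases hee : e' = e
      · subst hee
        rw [hal, pt_of_mem hmem] at h
        rcases ht1.lt_or_eq with ht | ht
        · rw [pt_of_mem (Γ := complete V) (e := e') ⟨ht0, ht⟩] at h
          have := congrArg Subtype.val (eq_of_heq (Point.interior.inj h).2)
          simp only at this
          linarith
        · rw [pt_of_length_le (Γ := complete V) (e := e') ht.ge] at h
          cases h
      · rw [pt_of_mem hmem] at h
        unfold along pt at h
        split_ifs at h
        all_goals exact hee (Point.interior.inj h).1
  rw [Firing.Q, Finsupp.finsetSum_apply]
  refine Finset.sum_pos' (fun e' he' => ?_) ⟨e, ?_, ?_⟩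
  · rw [Finsupp.sub_apply, Finsupp.single_apply, Finsupp.single_apply,
      if_neg (hne e' (Finset.mem_filter.1 he').2)]
    split_ifs <;> simp
  · exact Finset.mem_filter.2 ⟨Finset.mem_univ _, hcut⟩
  · rw [Finsupp.sub_apply, Finsupp.single_apply, Finsupp.single_apply, if_neg (hne e hcut), hal,
      if_pos rfl]
    simp

/-- Every cut chip moves by ε away from `A`, which is a firing. It is maximal because the chip of
the tight edge `(u, v)` arrives at `v`: a longer interval would have to start before this chip,
where there is none. By `hR` this includes the vertex `u`, where no chip of `R` can be waiting. -/
theorem MaximalRaise.exists_firing {R : V → V → Prop} (hR : ∀ u v w, R u v → ¬ R w u) {q : V}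
    {f f' : V → ℝ} (h : MaximalRaise R q f f') :
    ∃ F : (complete V).Firing, F.IsMaximalLegal q (chips R f) ∧
      chips R f' = chips R f - F.Q := by
  classical
  obtain ⟨hf, hf', A, ε, hq, hε, hff', u, hu, v, hv, huv, htight⟩ := h
  have hin : ∀ w ∈ A, f' w = f w + ε := fun w hw => by simp [hff', hw]
  have hout : ∀ w ∉ A, f' w = f w := fun w hw => by simp [hff', hw]
  have hpos1 : ∀ e : V × V, e.1 ∈ A → e.2 ∉ A → chipPos R f' e = chipPos R f e + ε := by
    intro e h1 h2
    rw [chipPos, chipPos, hin _ h1, hout _ h2]; ring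
  have hpos2 : ∀ e : V × V, e.1 ∉ A → e.2 ∈ A → chipPos R f' e = chipPos R f e - ε := by
    intro e h1 h2
    rw [chipPos, chipPos, hout _ h1, hin _ h2]; ring
  have hpos3 : ∀ e : V × V, ¬ IsCutEdge (Γ := complete V) A e →
      chipPos R f' e = chipPos R f e := by
    intro e hc
    have hc' : ¬ ((e.1 ∈ A ∧ e.2 ∉ A) ∨ (e.1 ∉ A ∧ e.2 ∈ A)) := hc
    by_cases h1 : e.1 ∈ A
    · have h2 : e.2 ∈ A := by tauto
      rw [chipPos, chipPos, hin _ h1, hin _ h2]; ring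
    · have h2 : e.2 ∉ A := by tauto
      rw [chipPos, chipPos, hout _ h1, hout _ h2]
  have hε2 : ε < 2 := by
    have h1 := abs_lt.1 (hf.1 u)
    have h2 := abs_lt.1 (hf'.1 u)
    linarith [hin u hu]
  let F : (complete V).Firing :=
    { A := A
      connected := complete_induce_connected (V := V) (A := A) ⟨u, hu⟩
      connected_compl := complete_induce_connected (V := V) (A := Aᶜ) ⟨v, hv⟩
      ε := ε
      ε_pos := hε
      ε_lt := fun _ _ => hε2
      -- Intervals start at the chips; `start` is measured from the endpoint in `A`, hence the
      -- reflection on edges oriented into `A`.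
      start := fun e : V × V => if e.1 ∈ A then chipPos R f e else 2 - chipPos R f e
      start_nonneg := fun e _ => by
        split_ifs
        · exact (hf.chipPos_pos e).le
        · linarith [hf.chipPos_le e]
      start_add_le := fun (e : V × V) he => by
        change (if e.1 ∈ A then chipPos R f e else 2 - chipPos R f e) + ε ≤ 2
        rcases he with ⟨h1, h2⟩ | ⟨h1, h2⟩
        · have h1' : e.1 ∈ A := h1
          rw [if_pos h1', ← hpos1 e h1 h2]
          exact hf'.chipPos_le e
        · have h1' : e.1 ∉ A := h1
          rw [if_neg h1']
          linarith [hf'.chipPos_pos e, hpos2 e h1 h2] }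
  have hQ : chips R f' = chips R f - F.Q := by
    rw [eq_sub_iff_add_eq', Firing.Q, Finset.sum_filter, chips, chips]
    change (∑ e : V × V, _) + _ = _
    rw [← Finset.sum_add_distrib]
    refine Finset.sum_congr rfl fun e _ => ?_
    split_ifs with hc
    · have hs : along (Γ := complete V) F.A e (F.start e) =
          pt (Γ := complete V) e (chipPos R f e) := by
        change (if e.1 ∈ A then pt (Γ := complete V) e (if e.1 ∈ A then _ else _)
          else pt (Γ := complete V) e (2 - if e.1 ∈ A then _ else _)) = _
        split_ifs
        · rfl
        · rw [sub_sub_cancel]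
      have ht : along (Γ := complete V) F.A e (F.start e + F.ε) =
          pt (Γ := complete V) e (chipPos R f' e) := by
        change (if e.1 ∈ A then pt (Γ := complete V) e ((if e.1 ∈ A then _ else _) + ε)
          else pt (Γ := complete V) e (2 - ((if e.1 ∈ A then _ else _) + ε))) = _
        rcases hc with ⟨h1, h2⟩ | ⟨h1, h2⟩
        · have h1' : e.1 ∈ A := h1
          rw [if_pos h1', if_pos h1', hpos1 e h1 h2]
        · have h1' : e.1 ∉ A := h1
          rw [if_neg h1', if_neg h1', hpos2 e h1 h2]
          congr 1
          ring
      rw [hs, ht]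
      abel
    · rw [hpos3 e hc]
      exact zero_add _
  refine ⟨F, ⟨⟨hq, fun p _ => hQ ▸ chips_nonneg R f' p⟩, fun g hg hgl => ?_⟩, hQ⟩
  by_contra! hlt
  have hlt' : ε < g.ε := hlt
  have hu' : u ∈ g.A := hg ▸ hu
  have hv' : v ∉ g.A := hg ▸ hv
  have h2 : chipPos R f' (u, v) = 2 := by
    rw [chipPos, if_pos huv, htight]; ring
  have h3 : g.start (u, v) + g.ε ≤ 2 := g.start_add_le (u, v) (Or.inl ⟨hu', hv'⟩)
  have hzero := chips_apply_eq_zero hf (e := (u, v)) (fun w => hR u v w huv)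
    (s := g.start (u, v)) (by linarith [hpos1 (u, v) hu hv])
  have hQpos := g.Q_pos (e := (u, v)) hu' hv'
  have hnn := hgl.nonneg (pt (Γ := complete V) (u, v) (g.start (u, v))) ?_
  · rw [Finsupp.sub_apply, hzero] at hnn
    linarith
  · intro h
    rcases (g.start_nonneg (u, v) (Or.inl ⟨hu', hv'⟩)).eq_or_lt with h0 | h0
    · rw [pt_of_nonpos h0.ge] at h
      exact hgl.toward ((Point.vertex.inj h) ▸ hu')
    · rw [pt_of_mem (Γ := complete V) ⟨h0, show g.start (u, v) < 2 by linarith⟩] at h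
      cases h

end Potential

end MetricGraph


/-! ### Transfinite paths and their concatenation -/

/-- On the interval `[a, b]` of ordinals, the family `F` increases, satisfies `step` at successors
and is left continuous at limits. -/
structure IsStepPath {X : Type*} [TopologicalSpace X] [Preorder X] (step : X → X → Prop)
    (F : Ordinal.{0} → X) (a b : Ordinal.{0}) : Prop where
  succ : ∀ α, a ≤ α → α < b → step (F α) (F (Order.succ α))
  limit : ∀ l, a < l → l ≤ b → Order.IsSuccLimit l → ∀ U ∈ nhds (F l),
    ∃ γ < l, ∀ α, γ < α → α < l → F α ∈ U
  between : ∀ α, a ≤ α → α ≤ b → F a ≤ F α ∧ F α ≤ F b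

namespace IsStepPath

variable {X : Type*} [TopologicalSpace X] [Preorder X] {step : X → X → Prop}
  {F : Ordinal.{0} → X} {a b c τ : Ordinal.{0}}

theorem refl (a : Ordinal.{0}) : IsStepPath step F a a where
  succ _ h h' := absurd (h.trans_lt h') (lt_irrefl _)
  limit _ h h' := absurd (h.trans_le h') (lt_irrefl _)
  between α h h' := by rw [le_antisymm h' h]; exact ⟨le_rfl, le_rfl⟩

theorem trans (hab : a ≤ b) (hbc : b ≤ c) (h1 : IsStepPath step F a b)
    (h2 : IsStepPath step F b c) : IsStepPath step F a c where
  succ α h h' := (lt_or_ge α b).elim (h1.succ α h) fun hb => h2.succ α hb h'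
  limit l h h' := (le_or_gt l b).elim (h1.limit l h) fun hb => h2.limit l hb h'
  between α h h' := by
    rcases le_total α b with hb | hb
    · exact ⟨(h1.between α h hb).1, (h1.between α h hb).2.trans (h2.between b le_rfl hbc).2⟩
    · exact ⟨(h1.between b hab le_rfl).1.trans (h2.between α hb h').1, (h2.between α hb h').2⟩

/-- Translation of a path. -/
theorem translate {G : Ordinal.{0} → X} (h : IsStepPath step G 0 τ)
    (hF : ∀ β ≤ τ, F (a + β) = G β) : IsStepPath step F a (a + τ) where
  succ α h1 h2 := by
    obtain ⟨β, rfl⟩ := exists_add_of_le h1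
    have hβ : β < τ := (add_lt_add_iff_left a).1 h2
    rw [Order.succ_eq_add_one, add_assoc, ← Order.succ_eq_add_one, hF β hβ.le, hF _ (Order.succ_le_of_lt hβ)]
    exact h.succ β zero_le hβ
  limit l h1 h2 hl U hU := by
    obtain ⟨β, rfl⟩ := exists_add_of_le h1.le
    have hβ : β ≤ τ := (add_le_add_iff_left a).1 h2
    have hβ0 : β ≠ 0 := by rintro rfl; simp at h1
    have hβl : Order.IsSuccLimit β := by
      rcases Ordinal.zero_or_succ_or_isSuccLimit β with h0 | ⟨γ, h0⟩ | h0
      · exact absurd h0 hβ0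
      · rw [← h0, Order.succ_eq_add_one, ← add_assoc, ← Order.succ_eq_add_one] at hl
        exact absurd hl (Order.not_isSuccLimit_succ _)
      · exact h0
    rw [hF β hβ] at hU
    obtain ⟨γ, hγ, H⟩ := h.limit β (pos_iff_ne_zero.2 hβ0) hβ hβl U hU
    refine ⟨a + γ, (add_lt_add_iff_left a).2 hγ, fun α h3 h4 => ?_⟩
    obtain ⟨δ, rfl⟩ := exists_add_of_le ((le_self_add).trans h3.le)
    have hδ := (add_lt_add_iff_left a).1 h4
    rw [hF δ (hδ.le.trans hβ)]
    exact H δ ((add_lt_add_iff_left a).1 h3) hδ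
  between α h1 h2 := by
    obtain ⟨β, rfl⟩ := exists_add_of_le h1
    have hβ : β ≤ τ := (add_le_add_iff_left a).1 h2
    have h0 := hF 0 zero_le
    rw [add_zero] at h0
    rw [h0, hF β hβ, hF τ le_rfl]
    exact h.between β zero_le hβ

end IsStepPath

/-- `y` is reached from `x` in time `τ`. -/
def StepReach {X : Type*} [TopologicalSpace X] [Preorder X] (step : X → X → Prop)
    (τ : Ordinal.{0}) (x y : X) : Prop :=
  ∃ F : Ordinal.{0} → X, F 0 = x ∧ F τ = y ∧ IsStepPath step F 0 τ

namespace StepReach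

variable {X : Type*} [TopologicalSpace X] [Preorder X] {step : X → X → Prop}
  {x y z : X} {σ τ : Ordinal.{0}}

theorem le (h : StepReach step τ x y) : x ≤ y := by
  obtain ⟨F, rfl, rfl, hF⟩ := h
  exact (hF.between τ zero_le le_rfl).1

theorem single (h : step x y) (hxy : x ≤ y) : StepReach step 1 x y := by
  classical
  refine ⟨fun α => if α = 0 then x else y, by simp, by simp, ?_, ?_, ?_⟩
  · intro α _ h1
    rw [Order.lt_one_iff] at h1
    subst h1
    simpa using h
  · intro l h0 h1 hl
    obtain rfl : l = 1 := le_antisymm h1 (Order.one_le_iff_pos.2 h0)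
    exact absurd hl (by simpa using Order.not_isSuccLimit_succ (0 : Ordinal.{0}))
  · intro α _ _
    by_cases h0 : α = 0 <;> simp [h0, hxy]

theorem trans (h1 : StepReach step σ x y) (h2 : StepReach step τ y z) :
    StepReach step (σ + τ) x z := by
  classical
  obtain ⟨F, rfl, rfl, hF⟩ := h1
  obtain ⟨G, hG0, rfl, hG⟩ := h2
  let H : Ordinal.{0} → X := fun α => if α ≤ σ then F α else G (α - σ)
  have hH1 : ∀ β ≤ σ, H (0 + β) = F β := fun β hβ => by simp [H, hβ]
  have hH2 : ∀ β ≤ τ, H (σ + β) = G β := by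
    intro β _
    by_cases h0 : β = 0
    · subst h0; simp [H, hG0]
    · have : ¬ σ + β ≤ σ := by simpa [pos_iff_ne_zero] using h0
      simp [H, this]
  have hp1 := hF.translate hH1
  rw [zero_add] at hp1
  refine ⟨H, by simpa using hH1 0 zero_le, hH2 τ le_rfl,
    hp1.trans zero_le le_self_add (hG.translate hH2)⟩

/-- Concatenation of `ω` many paths of the same length with converging endpoints. -/
theorem omega0 [(l : X) → Filter.TendstoIxxClass Set.Icc (nhds l) (nhds l)] [OrderClosedTopology X]
    (hτ : τ ≠ 0) {x : ℕ → X} (h : ∀ k, StepReach step τ (x k) (x (k + 1)))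
    (hy : Filter.Tendsto x Filter.atTop (nhds y)) :
    StepReach step (τ * Ordinal.omega0) (x 0) y := by
  classical
  choose F hF0 hFτ hF using h
  have hmono : Monotone x := monotone_nat_of_le_succ fun k => le ⟨F k, hF0 k, hFτ k, hF k⟩
  have hle : ∀ k, x k ≤ y := fun k => hmono.ge_of_tendsto hy k
  -- Euclidean division by τ finds the current path. Among times up to τω, the default `y` is used
  -- only at τω itself.
  let G : Ordinal.{0} → X := fun α =>
    if hα : ∃ k : ℕ, α / τ = k then F hα.choose (α % τ) else y
  have hG1 : ∀ (k : ℕ) (β : Ordinal.{0}), β < τ → G (τ * k + β) = F k β := by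
    intro k β hβ
    have hd : (τ * k + β) / τ = k := by
      rw [Ordinal.mul_add_div _ hτ, Ordinal.div_eq_zero_of_lt hβ, add_zero]
    have hm : (τ * k + β) % τ = β := by
      rw [Ordinal.mul_add_mod_self, Ordinal.mod_eq_of_lt hβ]
    have hα : ∃ m : ℕ, (τ * k + β) / τ = m := ⟨k, hd⟩
    have hch : hα.choose = k := by
      have := hα.choose_spec
      exact_mod_cast (hd.symm.trans this).symm
    simp only [G, dif_pos hα, hch, hm]
  have hsucc : ∀ k : ℕ, τ * ((k + 1 : ℕ) : Ordinal.{0}) = τ * k + τ := fun k => by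
    push_cast; rw [mul_add, mul_one]
  -- The value β = τ is allowed because each path ends where the next one begins.
  have hG2 : ∀ (k : ℕ) (β : Ordinal.{0}), β ≤ τ → G (τ * k + β) = F k β := by
    intro k β hβ
    rcases hβ.lt_or_eq with hβ | rfl
    · exact hG1 k β hβ
    · rw [hFτ, ← hF0, ← hG1 _ 0 (pos_iff_ne_zero.2 hτ), hsucc, add_zero]
  have hGx : ∀ k : ℕ, G (τ * k) = x k := fun k => by
    rw [← hF0, ← hG2 k 0 zero_le, add_zero]
  have hpath : ∀ k : ℕ, IsStepPath step G 0 (τ * k) := by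
    intro k
    induction k with
    | zero => simpa using IsStepPath.refl 0
    | succ k ih =>
      rw [hsucc]
      exact ih.trans zero_le le_self_add ((hF k).translate (hG2 k))
  have hcof : ∀ α < τ * Ordinal.omega0, ∃ k : ℕ, α < τ * k := by
    intro α hα
    obtain ⟨k, hk⟩ := Ordinal.lt_omega0.1 ((Ordinal.lt_mul_iff_div_lt hτ).1 hα)
    refine ⟨k + 1, ?_⟩
    have := Ordinal.lt_mul_succ_div α hτ
    rw [hk] at this
    simpa using this
  have hlt : ∀ k : ℕ, τ * k < τ * Ordinal.omega0 := fun k =>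
    mul_lt_mul_of_pos_left (Ordinal.natCast_lt_omega0 k) (pos_iff_ne_zero.2 hτ)
  have hGy : G (τ * Ordinal.omega0) = y := by
    refine dif_neg ?_
    rintro ⟨k, hk⟩
    rw [Ordinal.mul_div_cancel _ hτ] at hk
    exact (Ordinal.natCast_lt_omega0 k).ne' hk
  have hG0 : G 0 = x 0 := by simpa using hGx 0
  have hbet : ∀ (k : ℕ) (α : Ordinal.{0}), τ * k ≤ α → α < τ * Ordinal.omega0 →
      G α ∈ Set.Icc (x k) y := by
    intro k α h1 h2
    obtain ⟨m, hm⟩ := Ordinal.lt_omega0.1 ((Ordinal.lt_mul_iff_div_lt hτ).1 h2)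
    have hkm : k ≤ m := by
      have := (Ordinal.mul_le_iff_le_div hτ).1 h1
      rw [hm] at this
      exact_mod_cast this
    have hβ := Ordinal.mod_lt α hτ
    have hα : τ * m + α % τ = α := by rw [← hm, Ordinal.div_add_mod]
    have hb := (hF m).between _ zero_le hβ.le
    rw [← hG1 m _ hβ, hα, hF0, hFτ] at hb
    exact ⟨(hmono hkm).trans hb.1, hb.2.trans (hle _)⟩
  refine ⟨G, hG0, hGy, ?_, ?_, ?_⟩
  · intro α _ hα
    obtain ⟨k, hk⟩ := hcof α hα
    exact (hpath k).succ α zero_le hk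
  · intro l h0 hl hlim U hU
    rcases hl.lt_or_eq with hl | rfl
    · obtain ⟨k, hk⟩ := hcof l hl
      exact (hpath k).limit l h0 hk.le hlim U hU
    · rw [hGy] at hU
      -- By monotonicity all values after time τk lie in `[x k, y]`, and these intervals shrink to
      -- `y`; convergence of the endpoints therefore suffices.
      have hsm := (hy.Icc (l₂ := nhds y) tendsto_const_nhds).eventually
        (Filter.eventually_smallSets_subset.2 hU)
      obtain ⟨k, hk⟩ := hsm.exists
      exact ⟨τ * k, hlt k, fun α h1 h2 => hk (hbet k α h1.le h2)⟩
  · intro α _ hα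
    rw [hGy, hG0]
    rcases hα.lt_or_eq with hα | rfl
    · exact hbet 0 α (by simp) hα
    · rw [hGy]; exact ⟨hle 0, le_rfl⟩

end StepReach


/-! ### The levels, their gaps and the cuts -/

/-- The vertices of the example: three pairs of vertices on each of `N` levels. -/
abbrev LevelVertex (N : ℕ) : Type := Fin N × Fin 3 × Bool

namespace LevelVertex

open MetricGraph

variable {N : ℕ}

/-- The edges whose chips delimit the firings: one for each pair. -/
def Tight (u v : LevelVertex N) : Prop :=
  u.1 = v.1 ∧ u.2.1 = v.2.1 ∧ u.2.2 = false ∧ v.2.2 = true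

/-- The distance that remains to the chip of the `i`-th pair of level `l`. -/
def gap (f : LevelVertex N → ℝ) (l : Fin N) (i : Fin 3) : ℝ := f (l, i, true) - f (l, i, false)

@[simp] theorem gap_zero (l : Fin N) (i : Fin 3) : gap 0 l i = 0 := by simp [gap]

@[simp] theorem gap_add (f g : LevelVertex N → ℝ) (l : Fin N) (i : Fin 3) :
    gap (f + g) l i = gap f l i + gap g l i := by simp [gap]; ring

@[simp] theorem gap_smul (c : ℝ) (f : LevelVertex N → ℝ) (l : Fin N) (i : Fin 3) :
    gap (c • f) l i = c * gap f l i := by simp [gap]; ring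

theorem isFeasible_iff {f : LevelVertex N → ℝ} :
    IsFeasible Tight f ↔ (∀ v, |f v| < 1 / 2) ∧ ∀ l i, 0 ≤ gap f l i := by
  refine and_congr_right fun _ => ⟨fun h l i => sub_nonneg.2 (h _ _ ⟨rfl, rfl, rfl, rfl⟩), ?_⟩
  rintro h ⟨l, i, b⟩ ⟨l', i', b'⟩ ⟨h1, h2, h3, h4⟩
  dsimp at h1 h2 h3 h4
  subst h1 h2 h3 h4
  exact sub_nonneg.1 (h l i)

/-- Runs are monotone, so the size bound follows from the two ends and only the gaps need checking
on the way. -/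
theorem isFeasible_of_between {f g h : LevelVertex N → ℝ} (hf : IsFeasible Tight f)
    (hh : IsFeasible Tight h) (hfg : f ≤ g) (hgh : g ≤ h) (hg : ∀ l i, 0 ≤ gap g l i) :
    IsFeasible Tight g := by
  refine isFeasible_iff.2 ⟨fun v => abs_lt.2 ⟨?_, ?_⟩, hg⟩
  · linarith [(abs_lt.1 (hf.1 v)).1, hfg v]
  · linarith [(abs_lt.1 (hh.1 v)).2, hgh v]

/-- The vertices fired in the step `t` of level `j`: this moves the three chips of level `j`, and
resets one chip of the level below. -/
def cut (j : ℕ) (t : Fin 3) : Set (LevelVertex N) :=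
  {v | (v.1.val = j ∧ (v.2.1 = t ↔ v.2.2 = true)) ∨
    (v.1.val + 1 = j ∧ v.2.2 = true ∧ v.2.1 ≠ 0 ∧ t.val + v.2.1.val = 2)}

/-- The indicator function of a cut. -/
noncomputable def ind (j : ℕ) (t : Fin 3) : LevelVertex N → ℝ := (cut j t).indicator 1

theorem ind_nonneg (j : ℕ) (t : Fin 3) : (0 : LevelVertex N → ℝ) ≤ ind j t :=
  Set.indicator_nonneg fun _ _ => zero_le_one

theorem ind_of_lt {j : ℕ} (t : Fin 3) {v : LevelVertex N} (h : j < v.1.val) : ind j t v = 0 := by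
  refine Set.indicator_of_notMem ?_ _
  rintro (⟨h1, _⟩ | ⟨h1, _⟩) <;> omega

theorem gap_ind_of_lt {j : ℕ} (t : Fin 3) {l : Fin N} (i : Fin 3) (h : j < l.val) :
    gap (ind j t) l i = 0 := by
  simp [gap, ind_of_lt t (v := (l, i, _)) h]

theorem gap_ind_self {j : ℕ} (t : Fin 3) {l : Fin N} (i : Fin 3) (h : l.val = j) :
    gap (ind j t) l i = if i = t then 1 else -1 := by
  by_cases hi : i = t <;> simp [gap, ind, cut, h, hi]

/-- Step 0 reopens pair 2 below, step 1 reopens pair 1, and step 2 reopens nothing. -/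
theorem gap_ind_succ {j : ℕ} (t : Fin 3) {l : Fin N} (i : Fin 3) (h : l.val + 1 = j) :
    gap (ind j t) l i = if i ≠ 0 ∧ t.val + i.val = 2 then 1 else 0 := by
  classical
  have h' : l.val ≠ j := by omega
  simp [gap, ind, Set.indicator_apply, cut, h, h']

theorem gap_ind_of_gt {j : ℕ} (t : Fin 3) {l : Fin N} (i : Fin 3) (h : l.val + 1 < j) :
    gap (ind j t) l i = 0 := by
  classical
  have h' : l.val ≠ j := by omega
  simp [gap, ind, cut, h.ne, h']

/-- The profile of the gaps of a level that is ready to run. -/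
def profile (μ : ℝ) : Fin 3 → ℝ := ![0, 1, 1 + μ]

/-- Firing a set of vertices until the gap of the `i`-th pair of level `l` closes. -/
theorem stepReach_one {q : LevelVertex N} {A : Set (LevelVertex N)} {c : ℝ}
    {f : LevelVertex N → ℝ} (hq : q ∉ A) (hc : 0 < c) (hf : IsFeasible Tight f)
    (hf' : IsFeasible Tight (f + c • A.indicator 1)) {l : Fin N} {i : Fin 3}
    (hu : (l, i, false) ∈ A) (hv : (l, i, true) ∉ A)
    (h : gap (f + c • A.indicator 1) l i = 0) :
    StepReach (MaximalRaise Tight q) 1 f (f + c • A.indicator 1) := by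
  refine StepReach.single ⟨hf, hf', A, c, hq, hc, rfl, _, hu, _, hv, ⟨rfl, rfl, rfl, rfl⟩,
    (sub_eq_zero.1 h).symm⟩ ?_
  exact le_add_of_nonneg_right (smul_nonneg hc.le (Set.indicator_nonneg fun _ _ => zero_le_one))

theorem stepReach_ind {q : LevelVertex N} {j : ℕ} {t : Fin 3} {c : ℝ}
    {f : LevelVertex N → ℝ} (hq : j < q.1.val) (hc : 0 < c) (hf : IsFeasible Tight f)
    (hf' : IsFeasible Tight (f + c • ind j t)) {l : Fin N} (hl : l.val = j) {i : Fin 3}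
    (hi : i ≠ t) (h : gap (f + c • ind j t) l i = 0) :
    StepReach (MaximalRaise Tight q) 1 f (f + c • ind j t) := by
  refine stepReach_one ?_ hc hf hf' (l := l) (i := i) ?_ ?_ h
  · rintro (⟨h1, _⟩ | ⟨h1, _⟩) <;> omega
  · exact Or.inl ⟨hl, by simp [hi]⟩
  · rintro (⟨_, h1⟩ | ⟨h1, _⟩)
    · simp [hi] at h1
    · dsimp at h1; omega

/-! ### Runs of a level -/

/-- `g` is the total firing of a run of level `j` that takes time `τ`, when started from gaps with
the given profile. -/
structure IsRun (μ : ℝ) (q : LevelVertex N) (j : Fin N) (g : LevelVertex N → ℝ)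
    (τ : Ordinal.{0}) : Prop where
  nonneg : 0 ≤ g
  eq_zero : ∀ v : LevelVertex N, j < v.1 → g v = 0
  gap_lt : ∀ l < j, ∀ i, gap g l i = 0
  gap_self : ∀ i, gap g j i = -profile μ i
  reach : ∀ (c : ℝ) (f : LevelVertex N → ℝ), 0 < c → IsFeasible Tight f →
    IsFeasible Tight (f + c • g) → (∀ l < j, ∀ i, gap f l i = 0) →
    (∀ i, gap f j i = c * profile μ i) → StepReach (MaximalRaise Tight q) τ f (f + c • g)

theorem IsRun.gap_gt {μ : ℝ} {q : LevelVertex N} {j : Fin N} {g : LevelVertex N → ℝ}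
    {τ : Ordinal.{0}} (h : IsRun μ q j g τ) {l : Fin N} (hl : j < l) (i : Fin 3) :
    gap g l i = 0 := by
  simp [gap, h.eq_zero (l, i, _) hl]

/-- With no level below, firing the `false` vertex of pair 1 and then that of pair 2 closes the two
nonzero gaps one at a time. -/
theorem exists_isRun_zero {μ : ℝ} (h0 : 0 < μ) {q : LevelVertex N} {j : Fin N} (hj : j.val = 0)
    (hq : j < q.1) : ∃ (g : LevelVertex N → ℝ), IsRun μ q j g 2 := by
  classical
  let A : Fin 3 → Set (LevelVertex N) := fun i => {(j, i, false)}
  have hA : ∀ i, (0 : LevelVertex N → ℝ) ≤ (A i).indicator 1 := fun i =>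
    Set.indicator_nonneg fun _ _ => zero_le_one
  have hgap : ∀ i l k, gap ((A i).indicator 1) l k = if l = j ∧ k = i then -1 else 0 := by
    intro i l k
    simp only [gap, Set.indicator_apply, A, Set.mem_singleton_iff, Prod.mk.injEq]
    simp
    split_ifs <;> simp
  have hqA : ∀ i, q ∉ A i := by
    rintro i rfl
    exact hq.false
  refine ⟨(A 1).indicator 1 + (1 + μ) • (A 2).indicator 1, ?_, ?_, ?_, ?_, ?_⟩
  · exact add_nonneg (hA 1) (smul_nonneg (by linarith) (hA 2))
  · intro v hv
    have : ∀ i, v ∉ A i := by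
      rintro i rfl
      exact hv.false
    simp [this]
  · intro l hl
    rw [Fin.lt_def, hj] at hl
    omega
  · intro i
    rw [gap_add, gap_smul, hgap, hgap]
    fin_cases i <;> simp [profile]
  · intro c f hc hf hf' _ hgf
    have e : f + c • ((A 1).indicator 1 + (1 + μ) • (A 2).indicator 1) =
        f + c • (A 1).indicator 1 + (c * (1 + μ)) • (A 2).indicator 1 := by
      rw [smul_add, smul_smul, add_assoc]
    rw [e] at hf' ⊢
    have hc' : 0 < c * (1 + μ) := by positivity
    have hf1 : IsFeasible Tight (f + c • (A 1).indicator 1) := by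
      refine isFeasible_of_between hf hf' (le_add_of_nonneg_right (smul_nonneg hc.le (hA 1)))
        (le_add_of_nonneg_right (smul_nonneg hc'.le (hA 2))) fun l i => ?_
      rw [gap_add, gap_smul, hgap]
      split_ifs with h
      · rw [h.1, h.2, hgf]
        simp [profile]
      · simpa using (isFeasible_iff.1 hf).2 l i
    rw [← one_add_one_eq_two]
    refine (stepReach_one (l := j) (i := 1) (hqA 1) hc hf hf1 rfl (by simp [A]) ?_).trans
      (stepReach_one (l := j) (i := 2) (hqA 2) hc' hf1 hf' rfl (by simp [A]) ?_)
    · rw [gap_add, gap_smul, hgap, hgf]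
      simp [profile]
    · rw [gap_add, gap_add, gap_smul, gap_smul, hgap, hgap, hgf]
      simp [profile]

/-! ### One round of a level, and the induction on levels -/

section Block

variable {μ : ℝ} {q : LevelVertex N} {j j' : Fin N} {g : LevelVertex N → ℝ} {τ : Ordinal.{0}}

/-- The total firing of three steps of level `j` followed by a run of the level below. -/
noncomputable def block (μ : ℝ) (j : ℕ) (g : LevelVertex N → ℝ) : LevelVertex N → ℝ :=
  ind j 0 + μ • ind j 1 + μ ^ 2 • ind j 2 + μ • g

theorem block_nonneg (h0 : 0 < μ) (hg : 0 ≤ g) (j : ℕ) : 0 ≤ block μ j g :=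
  add_nonneg (add_nonneg (add_nonneg (ind_nonneg j 0) (smul_nonneg h0.le (ind_nonneg j 1)))
    (smul_nonneg (sq_nonneg μ) (ind_nonneg j 2))) (smul_nonneg h0.le hg)

/-- The three steps open the gaps μ and 1 = μ(1 + μ) just below, and the run `μ • g` closes exactly
these. -/
theorem gap_block_of_lt (hg : IsRun μ q j g τ) (hj : j.val + 1 = j'.val) (hμ : μ ^ 2 = 1 - μ)
    {l : Fin N} (hl : l < j') (i : Fin 3) : gap (block μ j' g) l i = 0 := by
  simp only [block, gap_add, gap_smul]
  rcases (show l.val + 1 ≤ j'.val from hl).lt_or_eq with h | h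
  · rw [gap_ind_of_gt 0 i h, gap_ind_of_gt 1 i h, gap_ind_of_gt 2 i h,
      hg.gap_lt l (Fin.lt_def.2 (by omega))]
    simp
  · obtain rfl : l = j := Fin.ext (by omega)
    rw [gap_ind_succ 0 i h, gap_ind_succ 1 i h, gap_ind_succ 2 i h, hg.gap_self]
    fin_cases i <;> simp [profile]
    linarith

theorem gap_block_self (hg : IsRun μ q j g τ) (hj : j.val + 1 = j'.val) (hμ : μ ^ 2 = 1 - μ)
    (i : Fin 3) : gap (block μ j' g) j' i = -((1 - μ ^ 3) * profile μ i) := by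
  have h3 : μ ^ 3 = 2 * μ - 1 := by
    rw [pow_succ, hμ]; linarith
  simp only [block, gap_add, gap_smul]
  rw [gap_ind_self 0 i rfl, gap_ind_self 1 i rfl, gap_ind_self 2 i rfl,
    hg.gap_gt (Fin.lt_def.2 (by omega)), h3, hμ]
  fin_cases i <;> simp [profile] <;> linarith

theorem block_eq_zero (hg : IsRun μ q j g τ) (hj : j.val + 1 = j'.val) {v : LevelVertex N}
    (hv : j' < v.1) : block μ j' g v = 0 := by
  have hv' : j < v.1 := Fin.lt_def.2 (by have := Fin.lt_def.1 hv; omega)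
  simp [block, ind_of_lt _ (Fin.lt_def.1 hv), hg.eq_zero v hv']

theorem stepReach_block (h0 : 0 < μ) (h1 : μ < 1) (hμ : μ ^ 2 = 1 - μ) (hg : IsRun μ q j g τ)
    (hj : j.val + 1 = j'.val) (hq : j' < q.1) {c : ℝ} {f : LevelVertex N → ℝ} (hc : 0 < c)
    (hf : IsFeasible Tight f) (hf' : IsFeasible Tight (f + c • block μ j' g))
    (hlt : ∀ l < j', ∀ i, gap f l i = 0) (hself : ∀ i, gap f j' i = c * profile μ i) :
    StepReach (MaximalRaise Tight q) (1 + 1 + 1 + τ) f (f + c • block μ j' g) := by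
  have h3 : μ ^ 3 = 2 * μ - 1 := by
    rw [pow_succ, hμ]; linarith
  have hj' : j < j' := Fin.lt_def.2 (by omega)
  have hcμ : 0 < c * μ := by positivity
  have hcμ2 : 0 < c * (1 - μ) := mul_pos hc (by linarith)
  set f1 := f + c • ind j' 0 with hf1
  set f2 := f1 + (c * μ) • ind j' 1 with hf2
  set f3 := f2 + (c * (1 - μ)) • ind j' 2 with hf3
  have e : f + c • block μ j' g = f3 + (c * μ) • g := by
    simp only [hf3, hf2, hf1, block, smul_add, smul_smul, hμ, add_assoc]
  rw [e] at hf' ⊢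
  have l1 : f ≤ f1 := le_add_of_nonneg_right (smul_nonneg hc.le (ind_nonneg _ _))
  have l2 : f1 ≤ f2 := le_add_of_nonneg_right (smul_nonneg hcμ.le (ind_nonneg _ _))
  have l3 : f2 ≤ f3 := le_add_of_nonneg_right (smul_nonneg hcμ2.le (ind_nonneg _ _))
  have l4 : f3 ≤ f3 + (c * μ) • g := le_add_of_nonneg_right (smul_nonneg hcμ.le hg.nonneg)
  have hfeas := (isFeasible_iff.1 hf).2
  have gap1 : ∀ l i, gap f1 l i = gap f l i + c * gap (ind j' 0) l i := by simp [hf1]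
  have gap2 : ∀ l i, gap f2 l i = gap f1 l i + c * μ * gap (ind j' 1) l i := by simp [hf2]
  have gap3 : ∀ l i, gap f3 l i = gap f2 l i + c * (1 - μ) * gap (ind j' 2) l i := by simp [hf3]
  -- The gaps go (0, 1, 1 + μ) → (1, 0, μ) → (1 - μ, μ, 0) → (0, 2μ - 1, 1 - μ), and the last is
  -- μ³(0, 1, 1 + μ).
  have s1 : ∀ i, gap f1 j' i = c * ![1, 0, μ] i := by
    intro i
    rw [gap1, hself, gap_ind_self 0 i rfl]
    fin_cases i <;> simp [profile] <;> ring
  have s2 : ∀ i, gap f2 j' i = c * ![1 - μ, μ, 0] i := by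
    intro i
    rw [gap2, s1, gap_ind_self 1 i rfl]
    fin_cases i <;> simp <;> ring
  have s3 : ∀ i, gap f3 j' i = c * ![0, 2 * μ - 1, 1 - μ] i := by
    intro i
    rw [gap3, s2, gap_ind_self 2 i rfl]
    fin_cases i <;> simp <;> ring
  have t1 : ∀ i, gap f1 j i = c * ![0, 0, 1] i := by
    intro i
    rw [gap1, hlt j hj', gap_ind_succ 0 i hj]
    fin_cases i <;> simp
  have t2 : ∀ i, gap f2 j i = c * ![0, μ, 1] i := by
    intro i
    rw [gap2, t1, gap_ind_succ 1 i hj]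
    fin_cases i <;> simp
  -- As 1 = μ(1 + μ), this is the profile at scale cμ, so the lower level is ready to run.
  have t3 : ∀ i, gap f3 j i = c * ![0, μ, 1] i := by
    intro i
    rw [gap3, t2, gap_ind_succ 2 i hj]
    fin_cases i <;> simp
  have u3 : ∀ l < j, ∀ i, gap f1 l i = 0 ∧ gap f2 l i = 0 ∧ gap f3 l i = 0 := by
    intro l hl i
    have hl' : l.val + 1 < j'.val := by have := Fin.lt_def.1 hl; omega
    rw [gap3, gap2, gap1, gap_ind_of_gt 0 i hl', gap_ind_of_gt 1 i hl', gap_ind_of_gt 2 i hl',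
      hlt l (hl.trans hj')]
    simp
  have v3 : ∀ l, j' < l → ∀ i, 0 ≤ gap f1 l i ∧ 0 ≤ gap f2 l i ∧ 0 ≤ gap f3 l i := by
    intro l hl i
    have hl' := Fin.lt_def.1 hl
    rw [gap3, gap2, gap1, gap_ind_of_lt 0 i hl', gap_ind_of_lt 1 i hl', gap_ind_of_lt 2 i hl']
    simpa using hfeas l i
  have hμ2 : 0 < 2 * μ - 1 := h3 ▸ pow_pos h0 3
  have hcases : ∀ l : Fin N, l < j ∨ l = j ∨ l = j' ∨ j' < l := by
    intro l
    simp only [Fin.lt_def, Fin.ext_iff]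
    omega
  have F1 : IsFeasible Tight f1 := by
    refine isFeasible_of_between hf hf' l1 (l2.trans (l3.trans l4)) fun l i => ?_
    rcases hcases l with h | rfl | rfl | h
    · exact (u3 l h i).1.ge
    · rw [t1]; refine mul_nonneg hc.le ?_; fin_cases i <;> simp
    · rw [s1]; refine mul_nonneg hc.le ?_; fin_cases i <;> simp [h0.le]
    · exact (v3 l h i).1
  have F2 : IsFeasible Tight f2 := by
    refine isFeasible_of_between hf hf' (l1.trans l2) (l3.trans l4) fun l i => ?_
    rcases hcases l with h | rfl | rfl | h
    · exact (u3 l h i).2.1.ge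
    · rw [t2]; refine mul_nonneg hc.le ?_; fin_cases i <;> simp [h0.le]
    · rw [s2]; refine mul_nonneg hc.le ?_; fin_cases i <;> simp [h0.le, h1.le]
    · exact (v3 l h i).2.1
  have F3 : IsFeasible Tight f3 := by
    refine isFeasible_of_between hf hf' (l1.trans (l2.trans l3)) l4 fun l i => ?_
    rcases hcases l with h | rfl | rfl | h
    · exact (u3 l h i).2.2.ge
    · rw [t3]; refine mul_nonneg hc.le ?_; fin_cases i <;> simp [h0.le]
    · rw [s3]; refine mul_nonneg hc.le ?_; fin_cases i <;> simp [h1.le]; linarith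
    · exact (v3 l h i).2.2
  have hq' := Fin.lt_def.1 hq
  -- The gaps that stop steps 0, 1, 2 are those of pairs 1, 2, 0.
  refine (((stepReach_ind hq' hc hf F1 rfl (i := 1) (by decide) ?_).trans
    (stepReach_ind hq' hcμ F1 F2 rfl (i := 2) (by decide) ?_)).trans
    (stepReach_ind hq' hcμ2 F2 F3 rfl (i := 0) (by decide) ?_)).trans
    (hg.reach (c * μ) f3 hcμ F3 hf' (fun l hl i => (u3 l hl i).2.2) fun i => ?_)
  · rw [← hf1, s1]; simp
  · rw [← hf2, s2]; simp
  · rw [← hf3, s3]; simp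
  · rw [t3]
    fin_cases i <;> simp [profile]
    linear_combination -c * hμ

/-- Each round multiplies the gaps of level `j'` by μ³ and leaves the lower gaps at zero, so it can
be repeated ω times; the total firing is a geometric series of blocks. -/
theorem IsRun.succ (h0 : 0 < μ) (h1 : μ < 1) (hμ : μ ^ 2 = 1 - μ) (hg : IsRun μ q j g τ)
    (hj : j.val + 1 = j'.val) (hq : j' < q.1) :
    IsRun μ q j' ((1 - μ ^ 3)⁻¹ • block μ j' g) ((1 + 1 + 1 + τ) * Ordinal.omega0) := by
  have hr1 : μ ^ 3 < 1 := pow_lt_one₀ h0.le h1 (by norm_num)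
  have hr0 : 0 < μ ^ 3 := pow_pos h0 3
  have hr : 0 < 1 - μ ^ 3 := by linarith
  have hb := block_nonneg h0 hg.nonneg j'
  refine ⟨smul_nonneg (inv_nonneg.2 hr.le) hb, ?_, ?_, ?_, ?_⟩
  · intro v hv
    simp [block_eq_zero hg hj hv]
  · intro l hl i
    rw [gap_smul, gap_block_of_lt hg hj hμ hl, mul_zero]
  · intro i
    rw [gap_smul, gap_block_self hg hj hμ]
    field_simp
  · intro c f hc hf hf' hlt hself
    have hx : ∀ k : ℕ, f + (c * ((1 - (μ ^ 3) ^ (k + 1)) * (1 - μ ^ 3)⁻¹)) • block μ j' g =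
        f + (c * ((1 - (μ ^ 3) ^ k) * (1 - μ ^ 3)⁻¹)) • block μ j' g +
          (c * (μ ^ 3) ^ k) • block μ j' g := by
      intro k
      rw [add_assoc, ← add_smul]
      congr 2
      field_simp
      ring
    -- The state after k rounds, with the geometric sum of ratio μ³ in closed form.
    set x : ℕ → LevelVertex N → ℝ := fun k =>
      f + (c * ((1 - (μ ^ 3) ^ k) * (1 - μ ^ 3)⁻¹)) • block μ j' g with hxdef
    have hpk : ∀ k : ℕ, 0 < (μ ^ 3) ^ k ∧ (μ ^ 3) ^ k ≤ 1 := fun k =>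
      ⟨pow_pos hr0 k, pow_le_one₀ hr0.le hr1.le⟩
    have hxlt : ∀ k, ∀ l < j', ∀ i, gap (x k) l i = 0 := by
      intro k l hl i
      simp [hxdef, hlt l hl, gap_block_of_lt hg hj hμ hl]
    have hxself : ∀ k i, gap (x k) j' i = c * (μ ^ 3) ^ k * profile μ i := by
      intro k i
      simp only [hxdef, gap_add, gap_smul, hself, gap_block_self hg hj hμ]
      field_simp
      ring
    have hxfeas : ∀ k, IsFeasible Tight (x k) := by
      intro k
      refine isFeasible_of_between hf hf' (le_add_of_nonneg_right (smul_nonneg ?_ hb)) ?_ ?_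
      · exact mul_nonneg hc.le (mul_nonneg (by linarith [(hpk k).2]) (inv_nonneg.2 hr.le))
      · rw [smul_smul]
        refine add_le_add le_rfl (smul_le_smul_of_nonneg_right ?_ hb)
        refine mul_le_mul_of_nonneg_left ?_ hc.le
        exact mul_le_of_le_one_left (inv_nonneg.2 hr.le) (by linarith [(hpk k).1])
      · intro l i
        rcases lt_trichotomy l j' with h | rfl | h
        · exact (hxlt k l h i).ge
        · rw [hxself]
          refine mul_nonneg (mul_nonneg hc.le (hpk k).1.le) ?_
          fin_cases i <;> simp [profile]
          linarith
        · have : gap (block μ j' g) l i = 0 := by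
            simp [gap, block_eq_zero hg hj (v := (l, i, _)) h]
          simpa [hxdef, this] using (isFeasible_iff.1 hf).2 l i
    have hx0 : x 0 = f := by simp [hxdef]
    have hlim : Filter.Tendsto x Filter.atTop (nhds (f + c • (1 - μ ^ 3)⁻¹ • block μ j' g)) := by
      have ht := tendsto_pow_atTop_nhds_zero_of_lt_one hr0.le hr1
      have ht' := ((((ht.const_sub 1).mul_const (1 - μ ^ 3)⁻¹).const_mul c).smul_const
        (block μ j' g)).const_add f
      rw [sub_zero, one_mul] at ht'
      rw [smul_smul]
      exact ht'
    have hstep : ∀ k, StepReach (MaximalRaise Tight q) (1 + 1 + 1 + τ) (x k) (x (k + 1)) := by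
      intro k
      have hfk := hxfeas (k + 1)
      have e : x (k + 1) = x k + (c * (μ ^ 3) ^ k) • block μ j' g := hx k
      rw [e] at hfk ⊢
      exact stepReach_block h0 h1 hμ hg hj hq (mul_pos hc (hpk k).1) (hxfeas k) hfk (hxlt k)
        (hxself k)
    have := StepReach.omega0 (by simp) hstep hlim
    rwa [hx0] at this

end Block

theorem exists_isRun {μ : ℝ} (h0 : 0 < μ) (h1 : μ < 1) (hμ : μ ^ 2 = 1 - μ)
    {q : LevelVertex N} (k : ℕ) :
    ∀ j : Fin N, j.val = k → j < q.1 → ∃ (g : LevelVertex N → ℝ) (τ : Ordinal.{0}),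
      Ordinal.omega0 ^ k ≤ τ ∧ IsRun μ q j g τ := by
  induction k with
  | zero =>
    intro j hj hq
    obtain ⟨g, hg⟩ := exists_isRun_zero h0 hj hq
    exact ⟨g, 2, by rw [pow_zero]; exact one_le_two, hg⟩
  | succ k ih =>
    intro j' hj hq
    have hk : k < N := by have := j'.2; omega
    obtain ⟨g, τ, hτ, hg⟩ := ih ⟨k, hk⟩ rfl (lt_trans (Fin.lt_def.2 (by simp [hj])) hq)
    refine ⟨_, _, ?_, hg.succ h0 h1 hμ hj.symm hq⟩
    rw [pow_succ]
    exact mul_le_mul_left (hτ.trans le_add_self) _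

end LevelVertex

/-! ### From potentials back to divisors -/

open MetricGraph in
/-- A transfinite sequence of maximal raises yields a greedy reduction. -/
theorem StepReach.isGreedyReduction {V : Type} [Fintype V] [Nontrivial V] {R : V → V → Prop}
    (hR : ∀ u v w, R u v → ¬ R w u) {q : V} {τ : Ordinal.{0}} {f f' : V → ℝ}
    (h : StepReach (MaximalRaise R q) τ f f') :
    ∃ S, IsGreedyReduction (Γ := complete V) q (chips R f) τ S := by
  obtain ⟨F, rfl, -, hF⟩ := h
  refine ⟨fun α => chips R (F α), rfl, fun α hα => (hF.succ α zero_le hα).exists_firing hR, ?_⟩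
  intro l hl hlim φ
  refine ((continuous_eval_chips R φ).tendsto (F l)).comp fun U hU => ?_
  have hl0 : 0 < l := pos_iff_ne_zero.2 (by rintro rfl; exact hlim.1 isMin_bot)
  obtain ⟨γ, hγ, H⟩ := hF.limit l hl0 hl hlim U hU
  rw [Filter.mem_map]
  exact Filter.mem_of_superset (Ioo_mem_nhdsLT hγ) fun α hα => H α hα.1 hα.2

open LevelVertex in
theorem theorem3 (n : ℕ) :
    ∃ (Γ : MetricGraph) (q : Γ.V) (D : Γ.Divisor),
      D.NonnegAwayFrom q ∧
      ∃ (τ : Ordinal.{0}) (S : Ordinal.{0} → Γ.Divisor),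
        Ordinal.omega0 ^ n ≤ τ ∧ MetricGraph.IsGreedyReduction q D τ S := by
  obtain ⟨μ, h0, h1, hμ⟩ : ∃ μ : ℝ, 0 < μ ∧ μ < 1 ∧ μ ^ 2 = 1 - μ := by
    refine ⟨-Real.goldenConj, by linarith [Real.goldenConj_neg],
      by linarith [Real.neg_one_lt_goldenConj], ?_⟩
    linarith [Real.goldenConj_sq, neg_sq Real.goldenConj]
  -- The sink lies on an extra level above level n, hence outside every fired set.
  let q : LevelVertex (n + 2) := (Fin.last _, 0, false)
  let j : Fin (n + 2) := (Fin.last n).castSucc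
  have hq : j < q.1 := Fin.castSucc_lt_last _
  obtain ⟨g, τ, hτ, hg⟩ := exists_isRun h0 h1 hμ n j rfl hq
  obtain ⟨M, hM⟩ := Finite.exists_le g
  have hM0 : 0 ≤ M := (hg.nonneg q).trans (hM q)
  let c : ℝ := 1 / (4 * (M + 1))
  have hc : 0 < c := by positivity
  have hcM : c * M < 1 / 2 := by
    rw [div_mul_eq_mul_div, div_lt_iff₀ (by positivity)]
    linarith
  have hgap : ∀ l i, gap (-(c • g)) l i = -(c * gap g l i) := fun l i => by
    rw [← neg_smul, gap_smul, neg_mul]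
  have hprofile : ∀ i, 0 ≤ profile μ i := by
    intro i
    fin_cases i <;> simp [profile]
    linarith
  -- Starting from `-(c • g)` makes the run end at potential zero; its initial gaps are then c times
  -- the profile, and the choice of c keeps the potential below 1/2.
  have hf : MetricGraph.IsFeasible Tight (-(c • g)) := by
    refine isFeasible_iff.2 ⟨fun v => ?_, fun l i => ?_⟩
    · have h2 := mul_nonneg hc.le (hg.nonneg v)
      have h3 := mul_le_mul_of_nonneg_left (hM v) hc.le
      rw [Pi.neg_apply, abs_neg, Pi.smul_apply, smul_eq_mul, abs_of_nonneg h2]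
      linarith
    · rw [hgap]
      rcases lt_trichotomy l j with h | rfl | h
      · rw [hg.gap_lt l h]; simp
      · rw [hg.gap_self, mul_neg, neg_neg]
        exact mul_nonneg hc.le (hprofile i)
      · rw [hg.gap_gt h]; simp
  have hf' : MetricGraph.IsFeasible Tight (-(c • g) + c • g) := by
    rw [neg_add_cancel]
    exact isFeasible_iff.2 (by simp)
  have hreach := hg.reach c (-(c • g)) hc hf hf'
    (fun l hl i => by rw [hgap, hg.gap_lt l hl]; simp) (fun i => by rw [hgap, hg.gap_self]; ring)
  have hR : ∀ u v w : LevelVertex (n + 2), Tight u v → ¬ Tight w u := by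
    rintro u v w ⟨-, -, h, -⟩ ⟨-, -, -, h'⟩
    simp [h] at h'
  obtain ⟨S, hS⟩ := hreach.isGreedyReduction hR
  exact ⟨MetricGraph.complete (LevelVertex (n + 2)), q, _,
    fun p _ => MetricGraph.chips_nonneg _ _ p, τ, S, hτ, hS⟩
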